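/- Throughout, $\|\cdot\|$ is the Euclidean norm and $B(\theta,\varepsilon)$ the closed ball. Let $K\subseteq\mathbb R^n$ ($n\ge 1$) be nonempty, closed and convex, with diameter $d\in[0,\infty]$, and let $\sigma>0$. For $\mu\in K$ let $Y=\mu+\xi$ with $\xi\sim N(0,\sigma^2\mathbb I_n)$, let $\hat\mu=\hat\mu(Y)=\operatorname{argmin}_{\nu\in K}\|Y-\nu\|^2$ be the least squares estimator, and put $\varepsilon_K=\big(\sup_{\mu\in K}\mathbb E\|\hat\mu-\mu\|^2\big)^{1/2}$. For $c^*>1$ and $\varepsilon>0$ let $M^{\mathrm{loc}}(\varepsilon)=\sup_{\theta\in K}M(\varepsilon/c^*,B(\theta,\varepsilon)\cap K)$, where $M(\eta,T)$ is the largest cardinality of a subset of $T$ whose distinct points are at distance $>\eta$. Let $$\underline\varepsilon=\sup\Big\{\varepsilon>0:\ \frac{\varepsilon^2}{2\sigma}\le\frac12\sup_{0<\delta\le\varepsilon}\frac{\delta}{c^*}\sqrt{\log M^{\mathrm{loc}}(\delta)}\Big\}\qquad(\sup\emptyset=0),$$ and, for $C>1$, let $C_n=4C\big(1+\log_{c^*}\sqrt{2\pi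 n}\big)^{3/2}$. **Theorem.** There are absolute constants $A>0$ and $c_0>1$ such that for every $c^*\ge c_0$ there is $C_0>1$, depending only on $c^*$, such that for all $C\ge C_0$, all $n\ge1$, all nonempty closed convex $K\subseteq\mathbb R^n$ and all $\sigma>0$, $$\varepsilon_K\le A\,\min\{4C_n\,\underline\varepsilon,\ d\}.$$ -/

import Mathlib

open MeasureTheory ProbabilityTheory
open scoped ENNReal NNReal

namespace ConvexLSE

noncomputable section

/-- The least squares estimator: a minimizer of `ν ↦ ‖y - ν‖²` over `K`.  For a nonempty closed
convex set `K` it exists (see `lse_spec`) and is unique (see `lse_unique`), so that `lse K` is the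
Euclidean projection onto `K`. -/
def lse {n : ℕ} (K : Set (EuclideanSpace ℝ (Fin n))) (y : EuclideanSpace ℝ (Fin n)) :
    EuclideanSpace ℝ (Fin n) :=
  Classical.epsilon fun ν => ν ∈ K ∧ IsMinOn (fun ν' => ‖y - ν'‖ ^ 2) K ν

theorem lse_spec {n : ℕ} {K : Set (EuclideanSpace ℝ (Fin n))} (hne : K.Nonempty)
    (hcl : IsClosed K) (hcv : Convex ℝ K) (y : EuclideanSpace ℝ (Fin n)) :
    lse K y ∈ K ∧ ∀ ν ∈ K, ‖y - lse K y‖ ^ 2 ≤ ‖y - ν‖ ^ 2 := by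
  have hex : ∃ ν, ν ∈ K ∧ IsMinOn (fun ν' => ‖y - ν'‖ ^ 2) K ν := by
    obtain ⟨v, hv, hmin⟩ := exists_norm_eq_iInf_of_complete_convex hne hcl.isComplete hcv y
    refine ⟨v, hv, fun w hw => ?_⟩
    have h : ‖y - v‖ ≤ ‖y - w‖ := by
      rw [hmin]
      exact ciInf_le (f := fun w : K => ‖y - w‖)
        ⟨0, Set.forall_mem_range.2 fun _ => norm_nonneg _⟩ ⟨w, hw⟩
    exact pow_le_pow_left₀ (norm_nonneg _) h 2
  have h := Classical.epsilon_spec hex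
  exact ⟨h.1, fun ν hν => h.2 hν⟩

theorem lse_unique {n : ℕ} {K : Set (EuclideanSpace ℝ (Fin n))}
    (hcl : IsClosed K) (hcv : Convex ℝ K) (y ν : EuclideanSpace ℝ (Fin n)) (hν : ν ∈ K)
    (hmin : ∀ ν' ∈ K, ‖y - ν‖ ^ 2 ≤ ‖y - ν'‖ ^ 2) : ν = lse K y := by
  obtain ⟨h1, h2⟩ := lse_spec ⟨ν, hν⟩ hcl hcv y
  have hmid : (1 / 2 : ℝ) • ν + (1 / 2 : ℝ) • lse K y ∈ K :=
    hcv hν h1 (by norm_num) (by norm_num) (by norm_num)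
  have h3 := hmin _ hmid
  have h4 := h2 _ hν
  have hp := parallelogram_law_with_norm ℝ (y - ν) (y - lse K y)
  have e1 : y - ν + (y - lse K y) =
      (2 : ℝ) • (y - ((1 / 2 : ℝ) • ν + (1 / 2 : ℝ) • lse K y)) := by module
  have e2 : y - ν - (y - lse K y) = lse K y - ν := by module
  rw [e1, e2, norm_smul] at hp
  norm_num at hp
  have h5 : ‖lse K y - ν‖ = 0 := by
    have := norm_nonneg (lse K y - ν)
    nlinarith
  exact (sub_eq_zero.1 (norm_eq_zero.1 h5)).symm

/-- The worst case risk `ε_K² = sup_{μ ∈ K} 𝔼 ‖μ̂(Y) - μ‖²` of the least squares estimator, where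
`Y = μ + ξ` and `ξ ∼ N(0, σ² I_n)`. -/
def worstRiskSq {n : ℕ} (K : Set (EuclideanSpace ℝ (Fin n))) (σ : ℝ) : ℝ≥0∞ :=
  ⨆ μ ∈ K, ∫⁻ ξ, ‖lse K (μ + ξ) - μ‖ₑ ^ 2
    ∂(multivariateGaussian (0 : EuclideanSpace ℝ (Fin n)) (σ ^ 2 • (1 : Matrix (Fin n) (Fin n) ℝ)))

/-- `ε_K`, the square root of the worst case risk. -/
def worstRate {n : ℕ} (K : Set (EuclideanSpace ℝ (Fin n))) (σ : ℝ) : ℝ≥0∞ :=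
  worstRiskSq K σ ^ (1 / 2 : ℝ)

/-- `M^loc(ε) = sup_{θ ∈ K} M(ε / c, B(θ, ε) ∩ K)`, where `M(η, T)` is the largest cardinality of a
subset of `T` whose distinct points are at distance `> η`. -/
def localPacking {n : ℕ} (c : ℝ) (K : Set (EuclideanSpace ℝ (Fin n))) (ε : ℝ) : ℕ∞ :=
  ⨆ θ ∈ K, Metric.packingNumber (ε / c).toNNReal (Metric.closedBall θ ε ∩ K)

theorem localPacking_ne_top {n : ℕ} {c ε : ℝ} (hc : 0 < c) (hε : 0 < ε)
    (K : Set (EuclideanSpace ℝ (Fin n))) : localPacking c K ε ≠ ⊤ := by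
  set r : ℝ≥0 := (ε / c).toNNReal with hr
  have hr0 : r ≠ 0 := by
    have : 0 < r := Real.toNNReal_pos.2 (div_pos hε hc)
    exact this.ne'
  have hle : localPacking c K ε ≤
      Metric.packingNumber r (Metric.closedBall (0 : EuclideanSpace ℝ (Fin n)) ε) := by
    refine iSup₂_le fun θ _ => ?_
    unfold Metric.packingNumber
    refine iSup_le fun C => iSup_le fun hC => iSup_le fun hsep => ?_
    have hinj : Function.Injective fun x : EuclideanSpace ℝ (Fin n) => x - θ := sub_left_injective
    rw [← hinj.injOn.encard_image (s := C)]
    refine Metric.IsSeparated.encard_le_packingNumber ?_ ?_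
    · rintro _ ⟨x, hx, rfl⟩
      have := (hC hx).1
      simpa [dist_eq_norm] using this
    · rintro _ ⟨x, hx, rfl⟩ _ ⟨y, hy, rfl⟩ hxy
      have := hsep hx hy (fun h => hxy (by rw [h]))
      simpa [edist_sub_right] using this
  refine ne_top_of_le_ne_top ?_ hle
  have h2 : Metric.packingNumber (2 * (r / 2))
      (Metric.closedBall (0 : EuclideanSpace ℝ (Fin n)) ε) ≠ ⊤ := by
    refine ne_top_of_le_ne_top ?_ (Metric.packingNumber_two_mul_le_externalCoveringNumber _ _)
    refine ne_top_of_le_ne_top ?_ (Metric.externalCoveringNumber_le_coveringNumber _ _)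
    obtain ⟨N, hN, hfin, hcov⟩ := Metric.exists_finite_isCover_of_isCompact
      (ε := r / 2) (by simpa using hr0) (isCompact_closedBall (0 : EuclideanSpace ℝ (Fin n)) ε)
    exact ne_top_of_le_ne_top (Set.encard_ne_top_iff.2 hfin) (hcov.coveringNumber_le_encard hN)
  rwa [mul_div_cancel₀ _ (two_ne_zero)] at h2

/-- The local entropy `log M^loc(ε)`; the cardinal is finite for `c, ε > 0`
(see `localPacking_ne_top`). -/
def localEntropy {n : ℕ} (c : ℝ) (K : Set (EuclideanSpace ℝ (Fin n))) (ε : ℝ) : ℝ :=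
  Real.log ((localPacking c K ε).toNat : ℝ)

/-- `sup_{0 < δ ≤ ε} (δ / c) √(log M^loc(δ))`. -/
def entropySup {n : ℕ} (c : ℝ) (K : Set (EuclideanSpace ℝ (Fin n))) (ε : ℝ) : ℝ≥0∞ :=
  ⨆ δ ∈ Set.Ioc 0 ε, ENNReal.ofReal (δ / c * √(localEntropy c K δ))

/-- The supremum of the `ε > 0` with
`ε² / (2σ) ≤ (1/2) sup_{0 < δ ≤ ε} (δ / c) √(log M^loc(δ))` (equal to `0` if there are none). -/
def epsLower {n : ℕ} (c : ℝ) (K : Set (EuclideanSpace ℝ (Fin n))) (σ : ℝ) : ℝ≥0∞ :=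
  ⨆ ε ∈ {ε : ℝ | 0 < ε ∧ ENNReal.ofReal (ε ^ 2 / (2 * σ)) ≤ 1 / 2 * entropySup c K ε},
    ENNReal.ofReal ε

/-- `C_n = 4 C (1 + log_c √(2πn))^{3/2}`. -/
def constC (C c : ℝ) (n : ℕ) : ℝ :=
  4 * C * (1 + Real.logb c √(2 * Real.pi * n)) ^ (3 / 2 : ℝ)

end

end ConvexLSE

namespace ConvexLSE

/-! ### Gaussian linear forms and maximal inequalities -/

section Gaussian

/-! Take any `t` strictly between `epsLower` and the diameter. The projection satisfies `‖μ̂ - θ‖² ≤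
⟨μ̂ - θ, ξ⟩`. By convexity, an error larger than `t` can be shrunk to radius `t`, so it is at most
`1/t` times the supremum of `⟨ν - θ, ξ⟩` over `ν ∈ K` with `‖ν - θ‖ ≤ t` (`norm_lse_sub_le_or`).

That supremum is bounded by chaining along the radii `t / c ^ k` (`exists_chain`). Since `t` exceeds
`epsLower`, the entropy at every scale `δ ≤ t` is at most `(c s / δ)²` with `s = t² / σ`. Squared
link length times entropy is then the same at every level, and each level contributes `O(c² t⁴)` to
the second moment. About `log_c √(2πn)` levels suffice: the remainder, of length at most `t / √n`,
is handled by Cauchy–Schwarz and `𝔼 ‖ξ‖² = O(n σ²)`. The risk is thus at most `(4 C_n t)²`, and `t`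
decreases to `epsLower`. If no such `t` exists, the trivial diameter bound is enough. -/

lemma integrable_exp_sq_gaussianReal {v : ℝ≥0} {w : ℝ} (hvw : (v : ℝ) ≤ w) :
    Integrable (fun x : ℝ => Real.exp (x ^ 2 / (4 * w))) (gaussianReal 0 v) ∧
      ∫ x, Real.exp (x ^ 2 / (4 * w)) ∂(gaussianReal 0 v) ≤ 2 := by
  rcases eq_or_ne v 0 with rfl | hv
  · rw [gaussianReal_zero_var]
    exact ⟨integrable_dirac (by simp), by simp⟩
  have hv0 : (0 : ℝ) < v := by positivity
  have hb : (0 : ℝ) < (4 * v : ℝ)⁻¹ := by positivity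
  have hprod : ∀ x : ℝ, gaussianPDFReal 0 v x * Real.exp (x ^ 2 / (4 * v)) =
      (√(2 * Real.pi * v))⁻¹ * Real.exp (-(4 * v : ℝ)⁻¹ * x ^ 2) := by
    intro x
    rw [gaussianPDFReal, mul_assoc, ← Real.exp_add]
    congr 2
    field_simp
    ring
  have hint : Integrable (fun x : ℝ => Real.exp (x ^ 2 / (4 * v))) (gaussianReal 0 v) := by
    rw [gaussianReal_of_var_ne_zero _ hv]
    unfold gaussianPDF
    rw [integrable_withDensity_iff_integrable_smul₀' (by fun_prop) (by simp)]
    refine ((integrable_exp_neg_mul_sq hb).const_mul (√(2 * Real.pi * v))⁻¹).congr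
      (Filter.Eventually.of_forall fun x => ?_)
    simp only [smul_eq_mul]
    rw [ENNReal.toReal_ofReal (gaussianPDFReal_nonneg _ _ _), hprod]
  -- The exponent is half the critical `1 / (2v)`: the product with the density is a Gaussian of
  -- variance `2v`, normalized for variance `v`.
  have hval : ∫ x, Real.exp (x ^ 2 / (4 * v)) ∂(gaussianReal 0 v) = √2 := by
    rw [integral_gaussianReal_eq_integral_smul hv]
    simp only [smul_eq_mul, hprod]
    rw [integral_const_mul, integral_gaussian, ← Real.sqrt_inv,
      ← Real.sqrt_mul (by positivity)]
    congr 1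
    field_simp
    ring
  have hle : ∀ x : ℝ, Real.exp (x ^ 2 / (4 * w)) ≤ Real.exp (x ^ 2 / (4 * v)) := by
    intro x
    gcongr
  have hint' : Integrable (fun x : ℝ => Real.exp (x ^ 2 / (4 * w))) (gaussianReal 0 v) := by
    refine hint.mono' (by fun_prop) (Filter.Eventually.of_forall fun x => ?_)
    rw [Real.norm_eq_abs, abs_of_pos (Real.exp_pos _)]
    exact hle x
  refine ⟨hint', (integral_mono hint' hint hle).trans (hval.trans_le ?_)⟩
  rw [Real.sqrt_le_left (by norm_num)]
  norm_num

variable {n : ℕ}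

/-- The isotropic Gaussian noise `N(0, σ² I_n)`. -/
noncomputable abbrev noise (n : ℕ) (σ : ℝ) : Measure (EuclideanSpace ℝ (Fin n)) :=
  multivariateGaussian (0 : EuclideanSpace ℝ (Fin n)) (σ ^ 2 • (1 : Matrix (Fin n) (Fin n) ℝ))

lemma noise_map_inner (σ : ℝ) (d : EuclideanSpace ℝ (Fin n)) :
    (noise n σ).map (fun ξ => inner ℝ d ξ) = gaussianReal 0 (σ ^ 2 * ‖d‖ ^ 2).toNNReal := by
  have hS : (σ ^ 2 • (1 : Matrix (Fin n) (Fin n) ℝ)).PosSemidef :=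
    Matrix.PosSemidef.one.smul (sq_nonneg σ)
  have h := IsGaussian.map_eq_gaussianReal (μ := noise n σ) (innerSL ℝ d)
  have h1 : (noise n σ)[innerSL ℝ d] = 0 := by
    rw [ContinuousLinearMap.integral_comp_id_comm IsGaussian.integrable_id,
      integral_id_multivariateGaussian, map_zero]
  have h2 : Var[innerSL ℝ d; noise n σ] = σ ^ 2 * ‖d‖ ^ 2 := by
    rw [← covariance_self (by fun_prop)]
    have h3 := covarianceBilin_apply_eq_cov (μ := noise n σ) (IsGaussian.memLp_two_id) d d
    have h4 : (innerSL ℝ d : EuclideanSpace ℝ (Fin n) → ℝ) = fun u => inner ℝ d u := rfl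
    rw [h4, ← h3, covarianceBilin_multivariateGaussian hS, Matrix.smul_mulVec, Matrix.one_mulVec,
      dotProduct_smul, EuclideanSpace.real_norm_sq_eq]
    simp [dotProduct, pow_two]
  rw [h1, h2] at h
  exact h

lemma integrable_exp_sq_inner_noise {σ ρ : ℝ}
    {d : EuclideanSpace ℝ (Fin n)} (hd : ‖d‖ ≤ ρ) :
    Integrable (fun ξ => Real.exp (inner ℝ d ξ ^ 2 / (4 * (σ ^ 2 * ρ ^ 2)))) (noise n σ) ∧
      ∫ ξ, Real.exp (inner ℝ d ξ ^ 2 / (4 * (σ ^ 2 * ρ ^ 2))) ∂(noise n σ) ≤ 2 := by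
  have hv : ((σ ^ 2 * ‖d‖ ^ 2).toNNReal : ℝ) ≤ σ ^ 2 * ρ ^ 2 := by
    rw [Real.coe_toNNReal _ (by positivity)]
    gcongr
  obtain ⟨h1, h2⟩ := integrable_exp_sq_gaussianReal (w := σ ^ 2 * ρ ^ 2) hv
  rw [← noise_map_inner] at h1 h2
  rw [integrable_map_measure (by fun_prop) (by fun_prop)] at h1
  rw [integral_map (by fun_prop) (by fun_prop)] at h2
  exact ⟨h1, h2⟩

/-- A maximal inequality for finitely many squared Gaussian linear forms. -/
lemma exists_integrable_bound_inner_sq {σ ρ L : ℝ} (hσ : 0 < σ) (hρ : 0 < ρ)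
    {D : Finset (EuclideanSpace ℝ (Fin n))} (hD : ∀ d ∈ D, ‖d‖ ≤ ρ)
    (hcard : (D.card : ℝ) ≤ Real.exp L) (hL : 0 ≤ L) :
    ∃ H : EuclideanSpace ℝ (Fin n) → ℝ, Integrable H (noise n σ) ∧ (∀ ξ, 0 ≤ H ξ) ∧
      (∀ ξ, ∀ d ∈ D, inner ℝ d ξ ^ 2 ≤ H ξ) ∧
      ∫ ξ, H ξ ∂(noise n σ) ≤ 4 * (σ ^ 2 * ρ ^ 2) * (L + 2) := by
  set w : ℝ := 4 * (σ ^ 2 * ρ ^ 2) with hw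
  have hw0 : 0 < w := by positivity
  have hint : ∀ d ∈ D, Integrable (fun ξ => Real.exp (inner ℝ d ξ ^ 2 / w)) (noise n σ) :=
    fun d hd => (integrable_exp_sq_inner_noise (hD d hd)).1
  -- From `u ≤ L + exp (u - L)` with the maximum over `D` replaced by a sum; the weight `exp (-L)`
  -- offsets the cardinality.
  refine ⟨fun ξ => w * (L + Real.exp (-L) * ∑ d ∈ D, Real.exp (inner ℝ d ξ ^ 2 / w)),
    ?_, ?_, ?_, ?_⟩
  · exact ((integrable_const _).add ((integrable_finsetSum _ hint).const_mul _)).const_mul _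
  · intro ξ
    positivity
  · intro ξ d hd
    have h1 : inner ℝ d ξ ^ 2 / w ≤ L + Real.exp (-L) * Real.exp (inner ℝ d ξ ^ 2 / w) := by
      rw [← Real.exp_add]
      have := Real.add_one_le_exp (-L + inner ℝ d ξ ^ 2 / w)
      linarith
    have h2 : Real.exp (inner ℝ d ξ ^ 2 / w) ≤ ∑ d ∈ D, Real.exp (inner ℝ d ξ ^ 2 / w) :=
      Finset.single_le_sum (f := fun d => Real.exp (inner ℝ d ξ ^ 2 / w))
        (fun _ _ => (Real.exp_pos _).le) hd
    rw [← div_le_iff₀' hw0]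
    exact h1.trans (by gcongr)
  · rw [integral_const_mul, integral_add (integrable_const _)
      ((integrable_finsetSum _ hint).const_mul _), integral_const_mul, integral_finsetSum _ hint]
    have h3 : ∑ d ∈ D, ∫ ξ, Real.exp (inner ℝ d ξ ^ 2 / w) ∂(noise n σ) ≤ Real.exp L * 2 := by
      calc _ ≤ ∑ d ∈ D, (2 : ℝ) :=
            Finset.sum_le_sum fun d hd => (integrable_exp_sq_inner_noise (hD d hd)).2
        _ = D.card * 2 := by simp
        _ ≤ _ := by gcongr
    have h4 : Real.exp (-L) * ∑ d ∈ D, ∫ ξ, Real.exp (inner ℝ d ξ ^ 2 / w) ∂(noise n σ) ≤ 2 := by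
      calc _ ≤ Real.exp (-L) * (Real.exp L * 2) := by gcongr
        _ = 2 := by rw [← mul_assoc, ← Real.exp_add]; simp
    have h5 : ∫ _, L ∂(noise n σ) = L := by simp
    rw [h5]
    gcongr

lemma integrable_norm_sq_noise {σ : ℝ} (hσ : 0 < σ) :
    Integrable (fun ξ => ‖ξ‖ ^ 2) (noise n σ) ∧ ∫ ξ, ‖ξ‖ ^ 2 ∂(noise n σ) ≤ 8 * n * σ ^ 2 := by
  have hcoord : ∀ i : Fin n, Integrable (fun ξ => ξ i ^ 2) (noise n σ) ∧
      ∫ ξ, ξ i ^ 2 ∂(noise n σ) ≤ 8 * σ ^ 2 := by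
    intro i
    obtain ⟨h1, h2⟩ := integrable_exp_sq_inner_noise (n := n) (σ := σ) (ρ := 1)
      (d := EuclideanSpace.single i 1) (by simp)
    have hle : ∀ ξ : EuclideanSpace ℝ (Fin n), ξ i ^ 2 ≤ (4 * σ ^ 2) *
        Real.exp (inner ℝ (EuclideanSpace.single i 1) ξ ^ 2 / (4 * (σ ^ 2 * 1 ^ 2))) := by
      intro ξ
      rw [← div_le_iff₀' (by positivity)]
      simp only [EuclideanSpace.inner_single_left, map_one, one_mul, one_pow, mul_one]
      linarith [Real.add_one_le_exp (ξ i ^ 2 / (4 * σ ^ 2))]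
    have hi : Integrable (fun ξ : EuclideanSpace ℝ (Fin n) => ξ i ^ 2) (noise n σ) := by
      refine (h1.const_mul (4 * σ ^ 2)).mono' (by fun_prop) (Filter.Eventually.of_forall fun ξ => ?_)
      rw [Real.norm_eq_abs, abs_of_nonneg (sq_nonneg _)]
      exact hle ξ
    refine ⟨hi, (integral_mono hi (h1.const_mul (4 * σ ^ 2)) hle).trans ?_⟩
    rw [integral_const_mul]
    nlinarith [sq_nonneg σ]
  simp only [EuclideanSpace.real_norm_sq_eq]
  refine ⟨integrable_finsetSum _ fun i _ => (hcoord i).1, ?_⟩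
  rw [integral_finsetSum _ fun i _ => (hcoord i).1]
  calc _ ≤ ∑ _i : Fin n, 8 * σ ^ 2 := Finset.sum_le_sum fun i _ => (hcoord i).2
    _ = _ := by simp; ring

end Gaussian

/-! ### Local nets, chaining and a lower bound on the entropy -/

section Chaining

variable {n : ℕ} {K : Set (EuclideanSpace ℝ (Fin n))} {c : ℝ}

/-- A maximal `δ / c`-separated subset of the local ball is also a `δ / c`-net of it. -/
lemma exists_local_net (hc : 0 < c) {δ : ℝ} (hδ : 0 < δ) {x : EuclideanSpace ℝ (Fin n)}
    (hx : x ∈ K) :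
    ∃ F : Finset (EuclideanSpace ℝ (Fin n)), (∀ y ∈ F, y ∈ K ∧ ‖y - x‖ ≤ δ) ∧
      (∀ z ∈ K, ‖z - x‖ ≤ δ → ∃ y ∈ F, ‖z - y‖ ≤ δ / c) ∧
      (F.card : ℝ) ≤ Real.exp (localEntropy c K δ) := by
  set A := Metric.closedBall x δ ∩ K with hA
  set r := (δ / c).toNNReal with hr
  have hle : Metric.packingNumber r A ≤ localPacking c K δ :=
    le_iSup₂ (f := fun θ _ => Metric.packingNumber r (Metric.closedBall θ δ ∩ K)) x hx
  have htop := localPacking_ne_top hc hδ K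
  have hptop : Metric.packingNumber r A ≠ ⊤ := ne_top_of_le_ne_top htop hle
  have hcardE := Metric.encard_maximalSeparatedSet hptop
  have hfin : (Metric.maximalSeparatedSet r A).Finite := by
    rw [← Set.encard_ne_top_iff, hcardE]
    exact hptop
  refine ⟨hfin.toFinset, ?_, ?_, ?_⟩
  · intro y hy
    have := Metric.maximalSeparatedSet_subset (hfin.mem_toFinset.1 hy)
    exact ⟨this.2, by simpa [dist_eq_norm] using this.1⟩
  · intro z hz hzx
    have hzA : z ∈ A := ⟨by simpa [dist_eq_norm] using hzx, hz⟩
    obtain ⟨y, hy, hzy⟩ := Metric.isCover_maximalSeparatedSet hptop hzA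
    refine ⟨y, hfin.mem_toFinset.2 hy, ?_⟩
    have h1 : edist z y ≤ r := hzy
    rw [edist_nndist, ENNReal.coe_le_coe, ← NNReal.coe_le_coe, coe_nndist,
      Real.coe_toNNReal _ (by positivity), dist_eq_norm] at h1
    exact h1
  · have h2 : hfin.toFinset.card ≤ (localPacking c K δ).toNat := by
      rw [hfin.encard_eq_coe_toFinset_card] at hcardE
      rw [← ENat.natCast_le_natCast, ENat.natCast_toNat htop, hcardE]
      exact hle
    rcases Nat.eq_zero_or_pos (localPacking c K δ).toNat with h0 | h0
    · rw [h0, Nat.le_zero] at h2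
      rw [h2]
      simpa using (Real.exp_pos _).le
    · rw [localEntropy, Real.exp_log (by exact_mod_cast h0)]
      exact_mod_cast h2

lemma geom_sum_le_two_mul_pow {q : ℝ} (hq : 2 ≤ q) (k : ℕ) :
    ∑ j ∈ Finset.range (k + 1), q ^ j ≤ 2 * q ^ k := by
  induction k with
  | zero => simp
  | succ k ih =>
    rw [Finset.sum_range_succ, pow_succ]
    have : 0 ≤ q ^ k := by positivity
    nlinarith

/-- Chaining: every point of `K` within `t` of `θ` is reached, up to an error `t / c ^ N`, by `N`
links taken from finite sets whose cardinalities are controlled by the local entropy. -/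
lemma exists_chain (hc : 2 ≤ c) {t a : ℝ} (ht : 0 < t)
    (hent : ∀ δ, 0 < δ → δ ≤ t → localEntropy c K δ ≤ (a / δ) ^ 2)
    {θ : EuclideanSpace ℝ (Fin n)} (hθ : θ ∈ K) :
    ∃ D : ℕ → Finset (EuclideanSpace ℝ (Fin n)),
      (∀ k, ∀ d ∈ D k, ‖d‖ ≤ t / c ^ k) ∧
      (∀ k, ((D k).card : ℝ) ≤ Real.exp (2 * (a / (t / c ^ k)) ^ 2)) ∧
      ∀ N, ∀ ν ∈ K, ‖ν - θ‖ ≤ t → ∃ d : ℕ → EuclideanSpace ℝ (Fin n),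
        (∀ k < N, d k ∈ D k) ∧ ‖ν - θ - ∑ k ∈ Finset.range N, d k‖ ≤ t / c ^ N := by
  classical
  have hc0 : 0 < c := by linarith
  have hδ : ∀ k : ℕ, 0 < t / c ^ k := fun k => by positivity
  have hδt : ∀ k : ℕ, t / c ^ k ≤ t := fun k =>
    div_le_self ht.le (one_le_pow₀ (by linarith))
  choose! F hF1 hF2 hF3 using fun (k : ℕ) (x : EuclideanSpace ℝ (Fin n)) (hx : x ∈ K) =>
    exists_local_net hc0 (hδ k) hx
  -- Generations of a tree rooted at `θ`: the children of `x` in generation `k` form a net of the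
  -- ball of radius `t / c ^ k` about `x`.
  let T : ℕ → Finset (EuclideanSpace ℝ (Fin n)) :=
    fun k => Nat.rec {θ} (fun k S => S.biUnion (F k)) k
  have hTs : ∀ k, T (k + 1) = (T k).biUnion (F k) := fun k => rfl
  have hTK : ∀ k, ∀ x ∈ T k, x ∈ K := by
    intro k
    induction k with
    | zero =>
      intro x hx
      rw [Finset.mem_singleton.1 hx]
      exact hθ
    | succ k ih =>
      intro x hx
      rw [hTs, Finset.mem_biUnion] at hx
      obtain ⟨y, hy, hxy⟩ := hx
      exact (hF1 k y (ih y hy) x hxy).1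
  have hFcard : ∀ k, ∀ x ∈ T k, ((F k x).card : ℝ) ≤ Real.exp ((a / (t / c ^ k)) ^ 2) :=
    fun k x hx => (hF3 k x (hTK k x hx)).trans
      (Real.exp_le_exp.2 (hent _ (hδ k) (hδt k)))
  have hstep : ∀ (k : ℕ) (G : EuclideanSpace ℝ (Fin n) → Finset (EuclideanSpace ℝ (Fin n))),
      (∀ x, (G x).card ≤ (F k x).card) →
      (((T k).biUnion G).card : ℝ) ≤ (T k).card * Real.exp ((a / (t / c ^ k)) ^ 2) := by
    intro k G hG
    calc (((T k).biUnion G).card : ℝ) ≤ ∑ x ∈ T k, ((G x).card : ℝ) := by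
          exact_mod_cast Finset.card_biUnion_le
      _ ≤ ∑ x ∈ T k, Real.exp ((a / (t / c ^ k)) ^ 2) := Finset.sum_le_sum fun x hx =>
          le_trans (by exact_mod_cast hG x) (hFcard k x hx)
      _ = _ := by simp
  have hTcard : ∀ k, ((T k).card : ℝ) ≤
      Real.exp (∑ j ∈ Finset.range k, (a / (t / c ^ j)) ^ 2) := by
    intro k
    induction k with
    | zero => simp [T]
    | succ k ih =>
      rw [Finset.sum_range_succ, Real.exp_add, hTs]
      exact (hstep k (F k) fun _ => le_rfl).trans (by gcongr)
  refine ⟨fun k => (T k).biUnion fun x => (F k x).image (· - x), ?_, ?_, ?_⟩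
  · intro k d hd
    simp only [Finset.mem_biUnion, Finset.mem_image] at hd
    obtain ⟨x, hx, y, hy, rfl⟩ := hd
    exact (hF1 k x (hTK k x hx) y hy).2
  · intro k
    refine (hstep k _ fun x => Finset.card_image_le).trans ?_
    refine (mul_le_mul_of_nonneg_right (hTcard k) (Real.exp_pos _).le).trans ?_
    rw [← Real.exp_add, ← Finset.sum_range_succ (fun j => (a / (t / c ^ j)) ^ 2)]
    -- The entropy bounds of successive generations grow with ratio `c ^ 2 ≥ 4`, so their sum is at
    -- most twice the last one.
    have e : ∀ j : ℕ, (a / (t / c ^ j)) ^ 2 = (a / t) ^ 2 * (c ^ 2) ^ j := by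
      intro j
      rw [← pow_mul, mul_comm 2 j, pow_mul]
      field_simp
    simp only [e, ← Finset.mul_sum]
    have := geom_sum_le_two_mul_pow (q := c ^ 2) (by nlinarith) k
    rw [Real.exp_le_exp, mul_left_comm]
    gcongr
  · intro N ν hν hνθ
    have key : ∃ d : ℕ → EuclideanSpace ℝ (Fin n),
        (∀ k < N, d k ∈ (T k).biUnion fun x => (F k x).image (· - x)) ∧
        θ + ∑ k ∈ Finset.range N, d k ∈ T N ∧
        ‖ν - (θ + ∑ k ∈ Finset.range N, d k)‖ ≤ t / c ^ N := by
      induction N with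
      | zero => exact ⟨0, by simp, by simp [T], by simpa using hνθ⟩
      | succ N ih =>
        obtain ⟨d, hd1, hd2, hd3⟩ := ih
        set x := θ + ∑ k ∈ Finset.range N, d k with hx
        obtain ⟨y, hy, hνy⟩ := hF2 N x (hTK N x hd2) ν hν hd3
        have hsum : θ + ∑ k ∈ Finset.range (N + 1), Function.update d N (y - x) k = y := by
          rw [Finset.sum_range_succ, Function.update_self,
            Finset.sum_congr rfl (g := d) fun k hk =>
              Function.update_of_ne (Finset.mem_range.1 hk).ne _ _, ← add_assoc, ← hx]
          abel
        refine ⟨Function.update d N (y - x), ?_, ?_, ?_⟩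
        · intro k hk
          rcases (Nat.lt_succ_iff.1 hk).lt_or_eq with h | rfl
          · rw [Function.update_of_ne h.ne]
            exact hd1 k h
          · rw [Function.update_self]
            exact Finset.mem_biUnion.2 ⟨x, hd2, Finset.mem_image_of_mem _ hy⟩
        · rw [hsum, hTs]
          exact Finset.mem_biUnion.2 ⟨x, hd2, hy⟩
        · rw [hsum, pow_succ, ← div_div]
          exact hνy
    obtain ⟨d, hd1, -, hd3⟩ := key
    exact ⟨d, hd1, by rwa [sub_sub]⟩

/-- A convex set of diameter greater than `t` has two points at distance `> t / c` in a ball of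
radius `t` around one of its points. -/
lemma log_two_le_localEntropy (hc : 1 < c) (hcv : Convex ℝ K) {t : ℝ} (ht : 0 < t)
    (hd : ENNReal.ofReal t < Metric.ediam K) : Real.log 2 ≤ localEntropy c K t := by
  have hc0 : 0 < c := by linarith
  obtain ⟨x, hx, y, hy, hxy⟩ : ∃ x ∈ K, ∃ y ∈ K, ENNReal.ofReal t < edist x y := by
    by_contra! h
    exact absurd (Metric.ediam_le h) (not_le.2 hd)
  have hxy' : t < ‖y - x‖ := by
    rw [edist_comm, edist_dist, dist_eq_norm] at hxy
    exact (ENNReal.ofReal_lt_ofReal_iff_of_nonneg ht.le).1 hxy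
  have hpos : 0 < ‖y - x‖ := ht.trans hxy'
  set z := x + (t / ‖y - x‖) • (y - x) with hz
  have hzK : z ∈ K := by
    apply hcv.add_smul_sub_mem hx hy
    exact ⟨by positivity, (div_le_one hpos).2 hxy'.le⟩
  have hzx : ‖z - x‖ = t := by
    rw [hz, add_sub_cancel_left, norm_smul, Real.norm_of_nonneg (by positivity)]
    field_simp
  have hne : x ≠ z := by
    rintro h
    rw [← h, sub_self, norm_zero] at hzx
    exact ht.ne hzx
  have hsep : Metric.IsSeparated ((t / c).toNNReal : ℝ≥0∞)
      ({x, z} : Set (EuclideanSpace ℝ (Fin n))) := by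
    have hlt : ((t / c).toNNReal : ℝ≥0∞) < edist z x := by
      rw [edist_dist, dist_eq_norm, hzx]
      exact (ENNReal.ofReal_lt_ofReal_iff ht).2 (div_lt_self ht hc)
    rintro a (rfl | rfl) b (rfl | rfl) hab
    · exact absurd rfl hab
    · rw [edist_comm]; exact hlt
    · exact hlt
    · exact absurd rfl hab
  have h2 : (2 : ℕ∞) ≤ localPacking c K t := by
    have h := Metric.IsSeparated.encard_le_packingNumber
      (A := Metric.closedBall x t ∩ K) (by
        rintro a (rfl | rfl)
        · exact ⟨Metric.mem_closedBall_self ht.le, hx⟩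
        · exact ⟨by rw [Metric.mem_closedBall, dist_eq_norm, hzx], hzK⟩) hsep
    rw [Set.encard_pair hne] at h
    exact h.trans (le_iSup₂ (f := fun θ _ =>
      Metric.packingNumber (t / c).toNNReal (Metric.closedBall θ t ∩ K)) x hx)
  have h3 : 2 ≤ (localPacking c K t).toNat := by
    rw [← ENat.natCast_le_natCast, ENat.natCast_toNat (localPacking_ne_top hc0 ht K)]
    exact h2
  exact Real.log_le_log two_pos (by exact_mod_cast h3)

end Chaining

/-! ### Localization and the risk bound -/

section Risk

variable {n : ℕ} {K : Set (EuclideanSpace ℝ (Fin n))} {c : ℝ}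

/-- The basic inequality for the projection onto a convex set. -/
lemma norm_lse_sub_sq_le (hcl : IsClosed K) (hcv : Convex ℝ K) {θ : EuclideanSpace ℝ (Fin n)}
    (hθ : θ ∈ K) (ξ : EuclideanSpace ℝ (Fin n)) :
    ‖lse K (θ + ξ) - θ‖ ^ 2 ≤ inner ℝ (lse K (θ + ξ) - θ) ξ := by
  obtain ⟨h1, h2⟩ := lse_spec ⟨θ, hθ⟩ hcl hcv (θ + ξ)
  set m := lse K (θ + ξ) with hm
  have hinf : ‖θ + ξ - m‖ = ⨅ w : K, ‖θ + ξ - w‖ := by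
    have : Nonempty K := ⟨⟨θ, hθ⟩⟩
    refine le_antisymm (le_ciInf fun w => ?_) ?_
    · exact le_of_sq_le_sq (h2 w w.2) (norm_nonneg _)
    · exact ciInf_le (f := fun w : K => ‖θ + ξ - w‖)
        ⟨0, Set.forall_mem_range.2 fun _ => norm_nonneg _⟩ ⟨m, h1⟩
  have h3 := (norm_eq_iInf_iff_real_inner_le_zero hcv h1).1 hinf θ hθ
  have e1 : θ + ξ - m = ξ - (m - θ) := by abel
  have e2 : θ - m = -(m - θ) := by abel
  rw [e1, e2, inner_neg_right, inner_sub_left, real_inner_self_eq_norm_sq, real_inner_comm] at h3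
  linarith

/-- The error of the least squares estimator is localized: either it is at most `t`, or it is
bounded by a linear functional of the noise on the ball of radius `t`. -/
lemma norm_lse_sub_le_or (hcl : IsClosed K) (hcv : Convex ℝ K) {θ : EuclideanSpace ℝ (Fin n)}
    (hθ : θ ∈ K) (ξ : EuclideanSpace ℝ (Fin n)) {t : ℝ} (ht : 0 < t) :
    ‖lse K (θ + ξ) - θ‖ ≤ t ∨ ∃ ν ∈ K, ‖ν - θ‖ ≤ t ∧
      t * ‖lse K (θ + ξ) - θ‖ ≤ inner ℝ (ν - θ) ξ := by
  rcases le_or_gt ‖lse K (θ + ξ) - θ‖ t with h | h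
  · exact Or.inl h
  · right
    have h1 := (lse_spec ⟨θ, hθ⟩ hcl hcv (θ + ξ)).1
    have h2 := norm_lse_sub_sq_le hcl hcv hθ ξ
    set m := lse K (θ + ξ) with hm
    have hpos : 0 < ‖m - θ‖ := ht.trans h
    -- The error vector is shrunk to length `t`; the basic inequality scales linearly.
    refine ⟨θ + (t / ‖m - θ‖) • (m - θ),
      hcv.add_smul_sub_mem hθ h1 ⟨by positivity, (div_le_one hpos).2 h.le⟩, ?_, ?_⟩
    · rw [add_sub_cancel_left, norm_smul, Real.norm_of_nonneg (by positivity)]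
      apply le_of_eq
      field_simp
    · rw [add_sub_cancel_left, real_inner_smul_left]
      calc t * ‖m - θ‖ = t / ‖m - θ‖ * ‖m - θ‖ ^ 2 := by field_simp
        _ ≤ _ := by gcongr

/-- Along a chain, `⟨ν - θ, ξ⟩` is a sum of `N + 1` terms, so its square costs a factor `N + 1`;
each squared term is dominated by a variable of mean at most `24 c² (σ s)²`. -/
lemma lintegral_norm_lse_sub_sq_le (hn : 1 ≤ n) (hc : 2 ≤ c) (hcl : IsClosed K)
    (hcv : Convex ℝ K) {σ t s : ℝ} (hσ : 0 < σ) (ht : 0 < t)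
    (hd : ENNReal.ofReal t < Metric.ediam K)
    (hs : ∀ δ, 0 < δ → δ ≤ t → δ / c * √(localEntropy c K δ) ≤ s)
    {θ : EuclideanSpace ℝ (Fin n)} (hθ : θ ∈ K) {N : ℕ} (hN : √(2 * Real.pi * n) ≤ c ^ N) :
    ∫⁻ ξ, ‖lse K (θ + ξ) - θ‖ₑ ^ 2 ∂(noise n σ) ≤
      ENNReal.ofReal (2 * t ^ 2 + 48 * c ^ 2 * (N + 1) ^ 2 * (σ * s) ^ 2 / t ^ 2) := by
  have hc0 : 0 < c := by linarith
  have hs0 : 0 ≤ s := le_trans (by positivity) (hs t ht le_rfl)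
  have hent : ∀ δ, 0 < δ → δ ≤ t → localEntropy c K δ ≤ (c * s / δ) ^ 2 := by
    intro δ hδ hδt
    rw [← Real.sqrt_le_left (by positivity), le_div_iff₀ hδ]
    have := hs δ hδ hδt
    rw [div_mul_eq_mul_div, div_le_iff₀ hc0] at this
    linarith
  -- As `t` is below the diameter, the entropy at `t` is at least `log 2 > 1/2`. This absorbs the
  -- additive constant of the maximal inequality and the remainder term.
  have hts : t ^ 2 ≤ 2 * c ^ 2 * s ^ 2 := by
    have h1 := (log_two_le_localEntropy (by linarith) hcv ht hd).trans (hent t ht le_rfl)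
    have h2 := Real.log_two_gt_d9
    rw [div_pow, le_div_iff₀ (by positivity), mul_pow] at h1
    nlinarith [sq_nonneg t]
  obtain ⟨D, hD1, hD2, hD3⟩ := exists_chain hc ht hent hθ
  choose H hH1 hH2 hH3 hH4 using fun k => exists_integrable_bound_inner_sq hσ
    (show 0 < t / c ^ k by positivity) (hD1 k) (hD2 k) (by positivity)
  obtain ⟨hξ1, hξ2⟩ := integrable_norm_sq_noise (n := n) hσ
  set R : EuclideanSpace ℝ (Fin n) → ℝ :=
    fun ξ => ∑ k ∈ Finset.range N, H k ξ + (t / c ^ N) ^ 2 * ‖ξ‖ ^ 2 with hR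
  have hR0 : ∀ ξ, 0 ≤ R ξ := fun ξ =>
    add_nonneg (Finset.sum_nonneg fun k _ => hH2 k ξ) (by positivity)
  have hRint : Integrable R (noise n σ) :=
    (integrable_finsetSum _ fun k _ => hH1 k).add (hξ1.const_mul _)
  have hRbound : ∫ ξ, R ξ ∂(noise n σ) ≤ (N + 1) * (24 * c ^ 2 * (σ * s) ^ 2) := by
    rw [hR, integral_add (integrable_finsetSum _ fun k _ => hH1 k) (hξ1.const_mul _),
      integral_finsetSum _ fun k _ => hH1 k, integral_const_mul, add_mul, one_mul]
    refine add_le_add ?_ ?_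
    · calc _ ≤ ∑ k ∈ Finset.range N, 24 * c ^ 2 * (σ * s) ^ 2 := by
            refine Finset.sum_le_sum fun k _ => (hH4 k).trans ?_
            have hk : t / c ^ k ≤ t := div_le_self ht.le (one_le_pow₀ (by linarith))
            have hk0 : 0 < t / c ^ k := by positivity
            -- The link length cancels against the entropy bound, so the main term does not depend
            -- on `k`.
            have e : 4 * (σ ^ 2 * (t / c ^ k) ^ 2) * (2 * (c * s / (t / c ^ k)) ^ 2 + 2) =
                8 * σ ^ 2 * (c ^ 2 * s ^ 2 + (t / c ^ k) ^ 2) := by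
              field_simp
              ring
            rw [e]
            have h1 : (t / c ^ k) ^ 2 ≤ 2 * c ^ 2 * s ^ 2 :=
              le_trans (by gcongr) hts
            calc 8 * σ ^ 2 * (c ^ 2 * s ^ 2 + (t / c ^ k) ^ 2)
                ≤ 8 * σ ^ 2 * (c ^ 2 * s ^ 2 + 2 * c ^ 2 * s ^ 2) := by gcongr
              _ = _ := by ring
        _ = _ := by simp
    -- The choice of `N` compensates the dimension in `𝔼 ‖ξ‖²`.
    · have h1 : (n : ℝ) ≤ (c ^ N) ^ 2 := by
        have h2 : 2 * Real.pi * n ≤ (c ^ N) ^ 2 := by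
          rwa [Real.sqrt_le_left (by positivity)] at hN
        have h3 : (0 : ℝ) ≤ n := by positivity
        nlinarith [Real.pi_gt_three]
      calc (t / c ^ N) ^ 2 * ∫ ξ, ‖ξ‖ ^ 2 ∂(noise n σ)
          ≤ (t / c ^ N) ^ 2 * (8 * n * σ ^ 2) := by gcongr
        _ ≤ (t / c ^ N) ^ 2 * (8 * (c ^ N) ^ 2 * σ ^ 2) := by gcongr
        _ = 8 * σ ^ 2 * t ^ 2 := by field_simp
        _ ≤ 8 * σ ^ 2 * (2 * c ^ 2 * s ^ 2) := by gcongr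
        _ ≤ 24 * c ^ 2 * (σ * s) ^ 2 := by nlinarith [sq_nonneg (c * σ * s)]
  have hchain : ∀ ξ, ∀ ν ∈ K, ‖ν - θ‖ ≤ t → inner ℝ (ν - θ) ξ ^ 2 ≤ (N + 1) * R ξ := by
    intro ξ ν hν hνθ
    obtain ⟨d, hd1, hd2⟩ := hD3 N ν hν hνθ
    set e := ν - θ - ∑ k ∈ Finset.range N, d k with he
    have hsplit : inner ℝ (ν - θ) ξ =
        ∑ k ∈ Finset.range (N + 1), (if k < N then inner ℝ (d k) ξ else inner ℝ e ξ) := by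
      rw [Finset.sum_range_succ, if_neg (lt_irrefl _),
        Finset.sum_congr rfl (g := fun k => inner ℝ (d k) ξ) fun k hk =>
          if_pos (Finset.mem_range.1 hk), ← sum_inner, ← inner_add_left, he,
        add_sub_cancel]
    rw [hsplit]
    refine (sq_sum_le_card_mul_sum_sq (s := Finset.range (N + 1))).trans ?_
    rw [Finset.card_range, Nat.cast_add_one, Finset.sum_range_succ, if_neg (lt_irrefl _)]
    gcongr
    refine add_le_add (Finset.sum_le_sum fun k hk => ?_) ?_
    · rw [if_pos (Finset.mem_range.1 hk)]
      exact hH3 k ξ (d k) (hd1 k (Finset.mem_range.1 hk))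
    · rw [← mul_pow, ← sq_abs]
      gcongr
      exact (abs_real_inner_le_norm _ _).trans (by gcongr)
  have hpt : ∀ ξ, ‖lse K (θ + ξ) - θ‖ ^ 2 ≤ 2 * t ^ 2 + 2 * ((N + 1) * R ξ) / t ^ 2 := by
    intro ξ
    have hR' : 0 ≤ (N + 1) * R ξ := mul_nonneg (by positivity) (hR0 ξ)
    rcases norm_lse_sub_le_or hcl hcv hθ ξ ht with h | ⟨ν, hν, hνθ, h⟩
    · have h1 : ‖lse K (θ + ξ) - θ‖ ^ 2 ≤ t ^ 2 := by gcongr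
      have h2 : 0 ≤ 2 * ((N + 1) * R ξ) / t ^ 2 := by positivity
      nlinarith [sq_nonneg t]
    · have h1 : (t * ‖lse K (θ + ξ) - θ‖) ^ 2 ≤ (N + 1) * R ξ :=
        le_trans (by gcongr) (hchain ξ ν hν hνθ)
      have h2 : ‖lse K (θ + ξ) - θ‖ ^ 2 ≤ (N + 1) * R ξ / t ^ 2 := by
        rw [le_div_iff₀ (by positivity)]
        linarith [mul_pow t ‖lse K (θ + ξ) - θ‖ 2]
      have h3 : 2 * ((N + 1) * R ξ) / t ^ 2 = 2 * ((N + 1) * R ξ / t ^ 2) := by ring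
      have h4 : 0 ≤ (N + 1) * R ξ / t ^ 2 := by positivity
      nlinarith [sq_nonneg t]
  have hGint : Integrable (fun ξ => 2 * t ^ 2 + 2 * ((N + 1) * R ξ) / t ^ 2) (noise n σ) :=
    (integrable_const _).add (((hRint.const_mul _).const_mul _).div_const _)
  calc ∫⁻ ξ, ‖lse K (θ + ξ) - θ‖ₑ ^ 2 ∂(noise n σ)
      ≤ ∫⁻ ξ, ENNReal.ofReal (2 * t ^ 2 + 2 * ((N + 1) * R ξ) / t ^ 2) ∂(noise n σ) := by
        refine lintegral_mono fun ξ => ?_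
        rw [← ofReal_norm, ← ENNReal.ofReal_pow (norm_nonneg _)]
        exact ENNReal.ofReal_le_ofReal (hpt ξ)
    _ = ENNReal.ofReal (∫ ξ, (2 * t ^ 2 + 2 * ((N + 1) * R ξ) / t ^ 2) ∂(noise n σ)) :=
        (ofReal_integral_eq_lintegral_ofReal hGint
          (Filter.Eventually.of_forall fun ξ => (sq_nonneg _).trans (hpt ξ))).symm
    _ ≤ _ := by
        apply ENNReal.ofReal_le_ofReal
        have h1 : ∫ _, 2 * t ^ 2 ∂(noise n σ) = 2 * t ^ 2 := by simp
        rw [integral_add (integrable_const _) (((hRint.const_mul _).const_mul _).div_const _), h1,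
          integral_div, integral_const_mul, integral_const_mul]
        gcongr 2 * t ^ 2 + ?_ / t ^ 2
        calc 2 * ((N + 1) * ∫ ξ, R ξ ∂(noise n σ))
            ≤ 2 * ((N + 1) * ((N + 1) * (24 * c ^ 2 * (σ * s) ^ 2))) := by gcongr
          _ = _ := by ring

lemma worstRate_le {a : ℝ≥0∞} {σ : ℝ}
    (h : ∀ θ ∈ K, ∫⁻ ξ, ‖lse K (θ + ξ) - θ‖ₑ ^ 2 ∂(noise n σ) ≤ a ^ 2) :
    worstRate K σ ≤ a := by
  have h1 : worstRiskSq K σ ≤ a ^ 2 := iSup₂_le h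
  calc worstRate K σ ≤ (a ^ 2) ^ (1 / 2 : ℝ) := ENNReal.rpow_le_rpow h1 (by norm_num)
    _ = a := by rw [← ENNReal.rpow_natCast, ← ENNReal.rpow_mul]; norm_num

lemma worstRate_le_ediam (hcl : IsClosed K) (hcv : Convex ℝ K) (σ : ℝ) :
    worstRate K σ ≤ Metric.ediam K := by
  refine worstRate_le fun θ hθ => ?_
  calc _ ≤ ∫⁻ _, Metric.ediam K ^ 2 ∂(noise n σ) := by
        refine lintegral_mono fun ξ => ?_
        gcongr
        rw [← edist_eq_enorm_sub]
        exact Metric.edist_le_ediam_of_mem (lse_spec ⟨θ, hθ⟩ hcl hcv _).1 hθ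
    _ = _ := by simp

/-- A `t` above the supremum violates the defining inequality of `epsLower`, which bounds the
entropy at all smaller scales. -/
lemma mul_sqrt_localEntropy_le_of_epsLower_lt {σ t : ℝ} (hσ : 0 < σ) (ht : 0 < t)
    (h : epsLower c K σ < ENNReal.ofReal t) {δ : ℝ} (hδ : 0 < δ) (hδt : δ ≤ t) :
    δ / c * √(localEntropy c K δ) ≤ t ^ 2 / σ := by
  have hnot : t ∉ {ε : ℝ | 0 < ε ∧
      ENNReal.ofReal (ε ^ 2 / (2 * σ)) ≤ 1 / 2 * entropySup c K ε} := fun hmem =>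
    absurd h (not_lt.2 (le_iSup₂ (f := fun ε _ => ENNReal.ofReal ε) t hmem))
  have h1 : 1 / 2 * entropySup c K t < ENNReal.ofReal (t ^ 2 / (2 * σ)) := by
    by_contra! h2
    exact hnot ⟨ht, h2⟩
  have h2 : ENNReal.ofReal (δ / c * √(localEntropy c K δ)) ≤ entropySup c K t :=
    le_iSup₂ (f := fun δ _ => ENNReal.ofReal (δ / c * √(localEntropy c K δ))) δ ⟨hδ, hδt⟩
  have h3 : ENNReal.ofReal (1 / 2 * (δ / c * √(localEntropy c K δ))) <
      ENNReal.ofReal (t ^ 2 / (2 * σ)) := by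
    rw [ENNReal.ofReal_mul (by norm_num)]
    refine lt_of_le_of_lt (mul_le_mul' ?_ h2) h1
    rw [ENNReal.ofReal_div_of_pos two_pos]
    simp
  have h4 := (ENNReal.ofReal_lt_ofReal_iff (by positivity)).1 h3
  have h5 : t ^ 2 / σ = 2 * (t ^ 2 / (2 * σ)) := by field_simp
  linarith

lemma exists_pow_ge_sqrt (hn : 1 ≤ n) (hc : 1 < c) :
    1 ≤ 1 + Real.logb c √(2 * Real.pi * n) ∧
    ∃ N : ℕ, √(2 * Real.pi * n) ≤ c ^ N ∧
      (N : ℝ) + 1 ≤ 2 * (1 + Real.logb c √(2 * Real.pi * n)) := by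
  have hn' : (1 : ℝ) ≤ n := by exact_mod_cast hn
  have h1 : 1 ≤ √(2 * Real.pi * n) := by
    rw [Real.one_le_sqrt]
    nlinarith [Real.pi_gt_three]
  have h0 : 0 ≤ Real.logb c √(2 * Real.pi * n) := Real.logb_nonneg hc h1
  refine ⟨by linarith, ⌈Real.logb c √(2 * Real.pi * n)⌉₊, ?_, ?_⟩
  · rw [← Real.rpow_natCast, ← Real.logb_le_iff_le_rpow hc (by linarith)]
    exact Nat.le_ceil _
  · have := Nat.ceil_lt_add_one h0
    linarith

lemma worstRate_le_of_epsLower_lt (hn : 1 ≤ n) (hc : 2 ≤ c) (hcl : IsClosed K)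
    (hcv : Convex ℝ K) {σ t C : ℝ} (hσ : 0 < σ) (hC : c ≤ C)
    (h : epsLower c K σ < ENNReal.ofReal t) (hd : ENNReal.ofReal t < Metric.ediam K) :
    worstRate K σ ≤ ENNReal.ofReal (4 * constC C c n) * ENNReal.ofReal t := by
  have ht : 0 < t := by
    by_contra! h0
    rw [ENNReal.ofReal_of_nonpos h0] at h
    exact not_lt_bot h
  obtain ⟨hL, N, hN1, hN2⟩ := exists_pow_ge_sqrt (n := n) (c := c) hn (by linarith)
  set L := 1 + Real.logb c √(2 * Real.pi * n) with hLdef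
  -- Only the first power of `L` is needed; the exponent `3/2` leaves slack since `L ≥ 1`.
  have hcon : 16 * c * L ≤ 4 * constC C c n := by
    have h1 : L ≤ L ^ (3 / 2 : ℝ) := by
      simpa using Real.rpow_le_rpow_of_exponent_le hL (show (1 : ℝ) ≤ 3 / 2 by norm_num)
    rw [constC, ← hLdef]
    have h2 : c * L ≤ C * L ^ (3 / 2 : ℝ) := by gcongr; linarith
    linarith
  rw [← ENNReal.ofReal_mul (by nlinarith)]
  refine worstRate_le fun θ hθ => ?_
  refine (lintegral_norm_lse_sub_sq_le (s := t ^ 2 / σ) hn hc hcl hcv hσ ht hd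
    (fun δ hδ hδt => mul_sqrt_localEntropy_le_of_epsLower_lt hσ ht h hδ hδt) hθ hN1).trans ?_
  have hcL : 0 ≤ c * L := by positivity
  rw [← ENNReal.ofReal_pow (mul_nonneg (by linarith) ht.le)]
  apply ENNReal.ofReal_le_ofReal
  have e : 2 * t ^ 2 + 48 * c ^ 2 * (N + 1) ^ 2 * (σ * (t ^ 2 / σ)) ^ 2 / t ^ 2 =
      (2 + 48 * c ^ 2 * (N + 1) ^ 2) * t ^ 2 := by field_simp
  rw [e, mul_pow]
  gcongr
  calc 2 + 48 * c ^ 2 * ((N : ℝ) + 1) ^ 2 ≤ 2 + 48 * c ^ 2 * (2 * L) ^ 2 := by gcongr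
    _ ≤ (16 * c * L) ^ 2 := by
      have : 1 ≤ c * L := by nlinarith
      nlinarith
    _ ≤ _ := by gcongr

end Risk

end ConvexLSE

theorem theorem2p10 :
    ∃ A : ℝ, 0 < A ∧ ∃ c₀ : ℝ, 1 < c₀ ∧ ∀ c : ℝ, c₀ ≤ c → ∃ C₀ : ℝ, 1 < C₀ ∧ ∀ C : ℝ, C₀ ≤ C →
      ∀ (n : ℕ) (_ : 1 ≤ n) (K : Set (EuclideanSpace ℝ (Fin n))) (_ : K.Nonempty)
        (_ : IsClosed K) (_ : Convex ℝ K) (σ : ℝ) (_ : 0 < σ),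
        ConvexLSE.worstRate K σ ≤
          ENNReal.ofReal A *
            min (ENNReal.ofReal (4 * ConvexLSE.constC C c n) * ConvexLSE.epsLower c K σ)
              (Metric.ediam K) := by
  refine ⟨1, one_pos, 2, one_lt_two, fun c hc => ⟨c, by linarith,
    fun C hC n hn K _ hcl hcv σ hσ => ?_⟩⟩
  rw [ENNReal.ofReal_one, one_mul]
  have hdiam := ConvexLSE.worstRate_le_ediam hcl hcv σ
  refine le_min ?_ hdiam
  have hcon : 1 ≤ 4 * ConvexLSE.constC C c n := by
    have h1 : (1 : ℝ) ≤ (1 + Real.logb c √(2 * Real.pi * n)) ^ (3 / 2 : ℝ) :=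
      Real.one_le_rpow (ConvexLSE.exists_pow_ge_sqrt hn (by linarith)).1 (by norm_num)
    rw [ConvexLSE.constC]
    nlinarith
  -- If the diameter is at most `epsLower`, no admissible `t` exists, but the diameter bound
  -- suffices because `4 C_n ≥ 1`.
  rcases le_or_gt (Metric.ediam K) (ConvexLSE.epsLower c K σ) with h | h
  · calc _ ≤ 1 * ConvexLSE.epsLower c K σ := by rw [one_mul]; exact hdiam.trans h
      _ ≤ _ := by gcongr; exact ENNReal.one_le_ofReal.2 hcon
  · have hne : ENNReal.ofReal (4 * ConvexLSE.constC C c n) ≠ 0 := by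
      rw [Ne, ENNReal.ofReal_eq_zero, not_le]
      linarith
    rw [mul_comm, ← ENNReal.div_le_iff hne ENNReal.ofReal_ne_top]
    -- `epsLower` is approached from above by radii `b` that stay below the diameter, hence are
    -- finite.
    refine le_of_forall_gt_imp_ge_of_dense fun a ha => ?_
    obtain ⟨b, hb1, hb2⟩ := exists_between (lt_min ha h)
    have hbtop : b ≠ ∞ := ((hb2.trans_le (min_le_right _ _)).trans_le le_top).ne
    rw [← ENNReal.ofReal_toReal hbtop] at hb1 hb2
    have := ConvexLSE.worstRate_le_of_epsLower_lt hn hc hcl hcv hσ hC hb1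
      (hb2.trans_le (min_le_right _ _))
    rw [mul_comm] at this
    exact (ENNReal.div_le_of_le_mul this).trans (hb2.le.trans (min_le_left _ _))
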